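/- Let $0<s<1$ and $\sigma=\sqrt{s(1-s)}$. Consider two equally sized groups $g\in\{1,2\}$ of units with independent binary outcomes, each equal to $1$ with the same probability $s$ in both groups. "Equally sized" is understood in either of two senses, and the result holds in both: (a) $N$ independent units are drawn, each belongs to either group with probability $1/2$, and given its group its outcome is Bernoulli($s$); or (b) $N=2M$ and each group has exactly $M$ units. Let $\hat s_g$ be the sample mean of the outcomes in group $g$, and let $$\hat{\mathrm{DP}}=\frac{\min_g\hat s_g}{\max_g\hat s_g},\qquad \mathrm{DP}_0=\frac{\min(s,s)}{\max(s,s)}=1,$$ with the conventions that the mean of an empty group is $0$ and that $0/0=0$. Let $Z_1,Z_2$ be independent standard normal variables. Then: 1. For every $N$, almost surely $\hat{\mathrm{DP}}\le \mathrm{DP}_0=1$, and hence $\sqrt N(\hat{\mathrm{DP}}-\mathrm{DP}_0)\le 0$. 2. As $N\to\infty$ (with $N=2M$ even in case (b)), $\sqrt N(\hat{\mathrm{DP}}-\mathrm{DP}_0)$ converges in distribution to $-\frac{\sqrt2\,\sigma}{s}|Z_1-Z_2|$. This variable has the half-normal law on the negative reals with scale $2\sigma/s$, i.e. the law of $-|X|$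 with $X\sim\mathcal N(0,4\sigma^2/s^2)$. 3. $\hat{\mathrm{DP}}$ is integrable and is not asymptotically unbiased at the scale $\sqrt N$: $\sqrt N(\hat{\mathrm{DP}}-\mathrm{DP}_0)$ does not converge in distribution to any integrable law with mean $0$, and $\sqrt N(\mathbb E[\hat{\mathrm{DP}}]-\mathrm{DP}_0)$ does not tend to $0$. 4. $\hat{\mathrm{DP}}$ is not asymptotically normal: $\sqrt N(\hat{\mathrm{DP}}-\mathrm{DP}_0)$ does not converge in distribution to any normal law (of any mean and any variance, zero included). -/

import Mathlib

open MeasureTheory ProbabilityTheory Filter Topology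

noncomputable section

/-- Demographic parity of a finite family of success rates: the smallest rate divided by the
largest one (with `0 / 0 = 0` when all rates vanish). -/
def demographicParity {ι : Type*} [Fintype ι] [Nonempty ι] (a : ι → ℝ) : ℝ :=
  (Finset.univ.inf' Finset.univ_nonempty a) / (Finset.univ.sup' Finset.univ_nonempty a)

/-- Multinomial sampling of units: unit `i` belongs to the random group `grp i` and has the binary
outcome `Y i`. The units are independent, unit `i` falls in group `g` with probability `p g`, and
given this its outcome is Bernoulli with success probability `s g`. -/
structure IsMultinomialSample {Ω : Type*} [MeasurableSpace Ω] (P : Measure Ω)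
    {ι : Type*} [MeasurableSpace ι] (p s : ι → ℝ) (grp : ℕ → Ω → ι) (Y : ℕ → Ω → ℝ) : Prop where
  measurable_grp : ∀ i, Measurable (grp i)
  measurable_outcome : ∀ i, Measurable (Y i)
  indep : iIndepFun (fun i ω => (grp i ω, Y i ω)) P
  success : ∀ i g, P.real {ω | grp i ω = g ∧ Y i ω = 1} = p g * s g
  failure : ∀ i g, P.real {ω | grp i ω = g ∧ Y i ω = 0} = p g * (1 - s g)

/-- Sample mean of group `g` among the first `N` units (`0` if the group is empty). -/
def groupMean {Ω ι : Type*} [DecidableEq ι] (grp : ℕ → Ω → ι) (Y : ℕ → Ω → ℝ) (N : ℕ) (ω : Ω)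
    (g : ι) : ℝ :=
  (∑ i ∈ Finset.range N, if grp i ω = g then Y i ω else 0) /
    (∑ i ∈ Finset.range N, if grp i ω = g then (1 : ℝ) else 0)

/-- Sampling with prescribed group sizes: `Y g i` is the binary outcome of the `i`-th unit of
group `g`; all outcomes are independent, and `Y g i` is Bernoulli with parameter `s g`. -/
structure IsStratifiedSample {Ω : Type*} [MeasurableSpace Ω] (P : Measure Ω)
    {ι : Type*} (s : ι → ℝ) (Y : ι → ℕ → Ω → ℝ) : Prop where
  measurable_outcome : ∀ g i, Measurable (Y g i)
  indep : iIndepFun (fun gi : ι × ℕ => Y gi.1 gi.2) P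
  success : ∀ g i, P.real {ω | Y g i ω = 1} = s g
  failure : ∀ g i, P.real {ω | Y g i ω = 0} = 1 - s g

/-- Sample mean of group `g` over its first `M` units. -/
def stratumMean {Ω ι : Type*} (Y : ι → ℕ → Ω → ℝ) (M : ℕ) (ω : Ω) (g : ι) : ℝ :=
  (∑ i ∈ Finset.range M, Y g i ω) / M

/-- `√N (T - θ)`, where the `k`-th estimate `T k` is computed from a sample of total size
`N = n k`. -/
def scaledError {Ω : Type*} (n : ℕ → ℕ) (T : ℕ → Ω → ℝ) (θ : ℝ) (k : ℕ) (ω : Ω) : ℝ :=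
  √(n k : ℝ) * (T k ω - θ)

/-- `√N (T - θ)` converges in distribution to a normal law; its mean and its variance are
arbitrary (variance zero allowed). -/
def AsymptoticallyNormal {Ω : Type*} [MeasurableSpace Ω] (P : Measure Ω) [IsProbabilityMeasure P]
    (n : ℕ → ℕ) (T : ℕ → Ω → ℝ) (θ : ℝ) : Prop :=
  ∃ (m : ℝ) (v : NNReal),
    TendstoInDistribution (scaledError n T θ) atTop (id : ℝ → ℝ) (fun _ => P) (gaussianReal m v)

/-- `√N (T - θ)` converges in distribution to a law with mean zero. -/
def AsymptoticallyUnbiasedInLaw {Ω : Type*} [MeasurableSpace Ω] (P : Measure Ω)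
    [IsProbabilityMeasure P] (n : ℕ → ℕ) (T : ℕ → Ω → ℝ) (θ : ℝ) : Prop :=
  ∃ (ν : Measure ℝ) (_ : IsProbabilityMeasure ν),
    TendstoInDistribution (scaledError n T θ) atTop (id : ℝ → ℝ) (fun _ => P) ν ∧
      Integrable id ν ∧ ∫ x, x ∂ν = 0

/-- The bias of `T` vanishes at the scale of the estimation error: `√N (E[T] - θ) → 0`. -/
def AsymptoticallyUnbiasedInMean {Ω : Type*} [MeasurableSpace Ω] (P : Measure Ω)
    (n : ℕ → ℕ) (T : ℕ → Ω → ℝ) (θ : ℝ) : Prop :=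
  Tendsto (fun k => √(n k : ℝ) * ((∫ ω, T k ω ∂P) - θ)) atTop (𝓝 0)

/-- The half-normal law on the negative reals with scale `τ`: the law of `-|X|` for
`X ∼ N(0, τ²)`. -/
def negHalfNormal (τ : ℝ) : Measure ℝ :=
  (gaussianReal 0 (Real.toNNReal (τ ^ 2))).map (fun x => -|x|)

end

/-!
For two rates `a`, `b` with positive maximum, `min a b / max a b - 1 = -|a - b| / max a b`. When
the true rates coincide, the demographic parity of the sample is thus governed by the absolute
value of the difference of the two sample means. By the strong law of large numbers the denominator
tends to `s`, and by the central limit theorem `√N (a - b)` tends in distribution to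
`√2 σ (Z₁ - Z₂)`, so Slutsky's theorem and the continuous mapping theorem give the limit
`-(√2 σ / s) |Z₁ - Z₂|`: see `tendstoInDistribution_sqrt_mul_min_div_max_sub_one`.

The two sampling schemes differ only in how the central limit theorem is obtained
(`IsMultinomialSample.tendstoInDistribution_groupMean_sub` and
`IsStratifiedSample.tendstoInDistribution_stratumMean_sub`). Both reduce to a one-dimensional
central limit theorem for a function of independent, identically distributed, finitely supported
variables (`IsIIDDiscrete.central_limit`): the pairs (group, outcome) in the first scheme, the pairs
formed by the `i`-th outcomes of the two groups in the second. With random group sizes the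
normalizations `N / N_g` are random, but they tend to `2` and their discrepancy multiplies a term
bounded in probability.

The limit law is the negative half-normal law. It has no atoms, does not charge the positive
half-line and has negative mean, which excludes every normal limit and every centred limit. Finally
the estimator never exceeds `1`, so a bias of order `o(N^{-1/2})` would force its scaled error
to tend to `0` in `L¹`, which the nondegenerate limit forbids.
-/

/-! ### Independent samples from a finitely supported law -/

/-- The variables `V i` are independent and identically distributed, with common law
`∑ x ∈ S, w x • δ_x` supported on the finite set `S`. The values of `w` outside `S` are
irrelevant, and `V i` may leave `S` on a null set. -/
structure IsIIDDiscrete {Ω α : Type*} [MeasurableSpace Ω] [MeasurableSpace α] (P : Measure Ω)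
    (V : ℕ → Ω → α) (S : Finset α) (w : α → ℝ) : Prop where
  measurable : ∀ i, Measurable (V i)
  indep : iIndepFun V P
  mass : ∀ i, ∀ x ∈ S, P.real {ω | V i ω = x} = w x
  total : ∑ x ∈ S, w x = 1

namespace IsIIDDiscrete

variable {Ω Ω' α : Type*} [MeasurableSpace Ω] [MeasurableSpace Ω'] [MeasurableSpace α]
  [MeasurableSingletonClass α] {P : Measure Ω} [IsProbabilityMeasure P]
  {P' : Measure Ω'} [IsProbabilityMeasure P']
  {V : ℕ → Ω → α} {S : Finset α} {w : α → ℝ}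

lemma map_singleton (h : IsIIDDiscrete P V S w) (i : ℕ) {x : α} (hx : x ∈ S) :
    P.map (V i) {x} = ENNReal.ofReal (w x) := by
  rw [Measure.map_apply (h.measurable i) (measurableSet_singleton x), ← h.mass i x hx,
    ofReal_measureReal]
  rfl

omit [MeasurableSingletonClass α] [IsProbabilityMeasure P] in
lemma weight_nonneg (h : IsIIDDiscrete P V S w) {x : α} (hx : x ∈ S) : 0 ≤ w x := by
  rw [← h.mass 0 x hx]; exact measureReal_nonneg

lemma ae_mem (h : IsIIDDiscrete P V S w) : ∀ᵐ ω ∂P, ∀ i, V i ω ∈ S := by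
  refine ae_all_iff.2 fun i => ?_
  have : IsProbabilityMeasure (P.map (V i)) :=
    Measure.isProbabilityMeasure_map (h.measurable i).aemeasurable
  refine ae_of_ae_map (h.measurable i).aemeasurable
    ((mem_ae_iff_prob_eq_one S.measurableSet).2 ?_)
  rw [← sum_measure_singleton, Finset.sum_congr rfl fun x hx => h.map_singleton i hx,
    ← ENNReal.ofReal_sum_of_nonneg fun x hx => h.weight_nonneg hx, h.total, ENNReal.ofReal_one]

lemma map_eq (h : IsIIDDiscrete P V S w) (i : ℕ) :
    P.map (V i) = ∑ x ∈ S, ENNReal.ofReal (w x) • Measure.dirac x := by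
  classical
  ext A hA
  have hS : P.map (V i) A = P.map (V i) (S.filter (· ∈ A) : Finset α) := by
    rw [Measure.map_apply (h.measurable i) hA,
      Measure.map_apply (h.measurable i) (Finset.measurableSet _)]
    refine measure_congr ?_
    filter_upwards [h.ae_mem] with ω hω
    simp only [Finset.coe_filter]
    exact propext ⟨fun hA => ⟨hω i, hA⟩, fun hA => hA.2⟩
  rw [hS, ← sum_measure_singleton, Finset.sum_filter]
  simp only [Measure.coe_finsetSum, Finset.sum_apply, Measure.coe_smul, Pi.smul_apply,
    Measure.dirac_apply' _ hA, smul_eq_mul, Set.indicator_apply, Pi.one_apply, mul_ite, mul_one,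
    mul_zero]
  exact Finset.sum_congr rfl fun x hx => by rw [h.map_singleton i hx]

lemma identDistrib (h : IsIIDDiscrete P V S w) (i : ℕ) : IdentDistrib (V i) (V 0) P P :=
  ⟨(h.measurable i).aemeasurable, (h.measurable 0).aemeasurable, by rw [h.map_eq, h.map_eq]⟩

lemma memLp (h : IsIIDDiscrete P V S w) {φ : α → ℝ} (hφ : Measurable φ) (i : ℕ)
    (p : ENNReal) : MemLp (fun ω => φ (V i ω)) p P := by
  refine MemLp.of_bound (hφ.comp (h.measurable i)).aestronglyMeasurable (∑ x ∈ S, |φ x|) ?_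
  filter_upwards [h.ae_mem] with ω hω
  exact Finset.single_le_sum (f := fun x => |φ x|) (fun x _ => abs_nonneg _) (hω i)

lemma integral_eq (h : IsIIDDiscrete P V S w) {φ : α → ℝ} (hφ : Measurable φ) (i : ℕ) :
    ∫ ω, φ (V i ω) ∂P = ∑ x ∈ S, w x * φ x := by
  rw [← integral_map (h.measurable i).aemeasurable hφ.aestronglyMeasurable, h.map_eq,
    integral_finsetSum_measure]
  · refine Finset.sum_congr rfl fun x hx => ?_
    rw [integral_smul_measure, integral_dirac, ENNReal.toReal_ofReal (h.weight_nonneg hx),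
      smul_eq_mul]
  · intro x _
    exact (integrable_dirac (by simp)).smul_measure ENNReal.ofReal_ne_top

lemma strong_law (h : IsIIDDiscrete P V S w) {φ : α → ℝ} (hφ : Measurable φ) :
    ∀ᵐ ω ∂P, Tendsto (fun N : ℕ => (∑ i ∈ Finset.range N, φ (V i ω)) / N) atTop
      (𝓝 (∑ x ∈ S, w x * φ x)) := by
  rw [← h.integral_eq hφ 0]
  exact strong_law_ae_real (fun i ω => φ (V i ω)) ((h.memLp hφ 0 1).integrable le_rfl)
    (fun i j hij => (h.indep.indepFun hij).comp hφ hφ) fun i => (h.identDistrib i).comp hφ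

lemma central_limit (h : IsIIDDiscrete P V S w) {φ : α → ℝ} (hφ : Measurable φ) {v : ℝ}
    (hmean : ∑ x ∈ S, w x * φ x = 0) (hvar : ∑ x ∈ S, w x * φ x ^ 2 = v) {Z : Ω' → ℝ}
    (hZ : HasLaw Z (gaussianReal 0 v.toNNReal) P') :
    TendstoInDistribution (fun (N : ℕ) ω => (√N)⁻¹ * ∑ i ∈ Finset.range N, φ (V i ω)) atTop Z
      (fun _ => P) P' := by
  have h0 : ∫ ω, φ (V 0 ω) ∂P = 0 := (h.integral_eq hφ 0).trans hmean
  have h1 : Var[fun ω => φ (V 0 ω); P] = v := by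
    have hm : Measurable fun ω => φ (V 0 ω) := hφ.comp (h.measurable 0)
    rw [variance_of_integral_eq_zero hm.aemeasurable h0, h.integral_eq (hφ.pow_const 2) 0, hvar]
  have := tendstoInDistribution_inv_sqrt_mul_sum_sub (P := P) (P' := P') (Y := Z)
    (X := fun i ω => φ (V i ω)) (by rwa [h1]) (h.memLp hφ 0 2)
    (h.indep.comp (fun _ => φ) fun _ => hφ) fun i => (h.identDistrib i).comp hφ
  simpa [h0] using this

end IsIIDDiscrete

/-! ### Regrouping a doubly indexed independent family -/

/-- For a doubly indexed independent family, the vectors `(Y i j)_i` are independent in `j`: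
the joint law is a product measure, and regrouping its factors gives the product of the laws of
the vectors. -/
lemma ProbabilityTheory.iIndepFun.curry_swap {Ω ι κ E : Type*} [MeasurableSpace Ω]
    [MeasurableSpace E] {P : Measure Ω} {Y : ι → κ → Ω → E} (hY : ∀ i j, Measurable (Y i j))
    (h : iIndepFun (fun p : ι × κ => Y p.1 p.2) P) :
    iIndepFun (fun j ω i => Y i j ω) P := by
  have := h.isProbabilityMeasure
  have hlaw : ∀ i j, IsProbabilityMeasure (P.map (Y i j)) :=
    fun i j => Measure.isProbabilityMeasure_map (hY i j).aemeasurable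
  have h' : iIndepFun (fun (p : (_ : κ) × ι) ω => Y p.2 p.1 ω) P :=
    h.precomp (g := fun p : (_ : κ) × ι => (p.2, p.1)) fun p q hpq => by
      cases p; cases q; simp_all
  have hrow : ∀ j, P.map (fun ω i => Y i j ω) = Measure.infinitePi fun i => P.map (Y i j) := by
    intro j
    exact (iIndepFun_iff_map_fun_eq_infinitePi_map fun i => hY i j).1
      (h.precomp (g := fun i => (i, j)) fun _ _ hij => congrArg Prod.fst hij)
  have hY' : ∀ p : (_ : κ) × ι, Measurable (Y p.2 p.1) := fun p => hY _ _
  -- the joint law regrouped by `j` is the image of the ungrouped one under currying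
  have hc : (MeasurableEquiv.piCurry fun (_ : κ) (_ : ι) => E) ∘
      (fun ω (p : (_ : κ) × ι) => Y p.2 p.1 ω) = fun ω j i => Y i j ω := by
    ext; simp [Sigma.curry]
  rw [iIndepFun_iff_map_fun_eq_infinitePi_map (by fun_prop), ← hc,
    ← Measure.map_map (by fun_prop) (by fun_prop),
    (iIndepFun_iff_map_fun_eq_infinitePi_map hY').1 h',
    Measure.infinitePi_map_piCurry (fun (j : κ) (i : ι) => P.map (Y i j))]
  simp_rw [hrow]

/-! ### Convergence in distribution and in probability -/

section Convergence

variable {Ω Ω' : Type*} [MeasurableSpace Ω] [MeasurableSpace Ω'] {P : Measure Ω}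
  [IsProbabilityMeasure P] {P' : Measure Ω'} [IsProbabilityMeasure P']

/-- Convergence in distribution to the constant `0` implies convergence in probability, by Markov's
inequality for the bounded continuous function `min |x| 1`. -/
lemma MeasureTheory.TendstoInDistribution.tendstoInMeasure_zero {X : ℕ → Ω → ℝ}
    (h : TendstoInDistribution X atTop (fun _ : Ω' => (0 : ℝ)) (fun _ => P) P') :
    TendstoInMeasure P X atTop (fun _ => 0) := by
  let f : BoundedContinuousFunction ℝ ℝ := BoundedContinuousFunction.ofNormedAddCommGroup
    (fun x => min |x| 1) (by fun_prop) 1 fun x => by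
      rw [Real.norm_eq_abs, abs_of_nonneg (by positivity)]; exact min_le_right _ _
  have hf : ∀ x, f x = min |x| 1 := fun x => rfl
  have hlim : Tendsto (fun k => ∫ ω, f (X k ω) ∂P) atTop (𝓝 0) := by
    have := (ProbabilityMeasure.tendsto_iff_forall_integral_tendsto.1 h.tendsto) f
    simp only [ProbabilityMeasure.coe_mk] at this
    simp_rw [fun k => integral_map (h.forall_aemeasurable k)
      (f.continuous.aestronglyMeasurable (μ := P.map (X k)))] at this
    simpa [hf, integral_map] using this
  rw [tendstoInMeasure_iff_measureReal_norm]
  intro ε hε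
  have hδ : 0 < min ε 1 := by positivity
  have hlim' := hlim.div_const (min ε 1)
  rw [zero_div] at hlim'
  refine squeeze_zero (fun _ => measureReal_nonneg) (fun k => ?_) hlim'
  rw [le_div_iff₀ hδ, mul_comm]
  have hint : Integrable (fun ω => f (X k ω)) P :=
    (f.integrable (P.map (X k))).comp_aemeasurable (h.forall_aemeasurable k)
  refine le_trans ?_ (mul_meas_ge_le_integral_of_nonneg
    (ae_of_all _ fun ω => by rw [hf]; exact (by positivity)) hint (min ε 1))
  refine mul_le_mul_of_nonneg_left (measureReal_mono fun ω hω => ?_) hδ.le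
  simp only [sub_zero, Set.mem_ofPred_eq, Real.norm_eq_abs] at hω
  exact min_le_min_right 1 hω

lemma MeasureTheory.TendstoInDistribution.mul_tendstoInMeasure_zero {X R : ℕ → Ω → ℝ} {Z : Ω' → ℝ}
    (hX : TendstoInDistribution X atTop Z (fun _ => P) P')
    (hR : TendstoInMeasure P R atTop (fun _ => 0)) (hRm : ∀ k, AEMeasurable (R k) P) :
    TendstoInMeasure P (fun k ω => R k ω * X k ω) atTop (fun _ => 0) := by
  refine TendstoInDistribution.tendstoInMeasure_zero (P' := P') ?_
  simpa using hX.continuous_comp_prodMk_of_tendstoInMeasure_const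
    (g := fun p : ℝ × ℝ => p.2 * p.1) (by fun_prop) hR hRm

/-- The limit in distribution does not change if, along almost every sample point, the sequence is
modified at finitely many indices (depending on the point). -/
lemma MeasureTheory.TendstoInDistribution.of_ae_eventuallyEq {X Y : ℕ → Ω → ℝ} {Z : Ω' → ℝ}
    (hX : TendstoInDistribution X atTop Z (fun _ => P) P') (hY : ∀ k, AEMeasurable (Y k) P)
    (h : ∀ᵐ ω ∂P, ∀ᶠ k in atTop, Y k ω = X k ω) :
    TendstoInDistribution Y atTop Z (fun _ => P) P' := by
  refine tendstoInDistribution_of_tendstoInMeasure_sub Y Z hX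
    (tendstoInMeasure_of_tendsto_ae
      (fun k => ((hY k).sub (hX.forall_aemeasurable k)).aestronglyMeasurable) ?_) hY
  filter_upwards [h] with ω hω
  refine tendsto_const_nhds.congr' ?_
  filter_upwards [hω] with k hk
  simp [hk]

lemma MeasureTheory.TendstoInDistribution.id_of_hasLaw {X : ℕ → Ω → ℝ} {Z : Ω' → ℝ}
    {ν : Measure ℝ} [IsProbabilityMeasure ν]
    (hX : TendstoInDistribution X atTop Z (fun _ => P) P') (hZ : HasLaw Z ν P') :
    TendstoInDistribution X atTop (id : ℝ → ℝ) (fun _ => P) ν := by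
  refine ⟨hX.forall_aemeasurable, aemeasurable_id, ?_⟩
  convert! hX.tendsto using 2
  exact congrArg 𝓝 (Subtype.ext (Measure.map_id.trans hZ.map_eq.symm))

end Convergence

/-! ### The ratio of the smaller to the larger rate -/

lemma demographicParity_fin_two (a : Fin 2 → ℝ) :
    demographicParity a = min (a 0) (a 1) / max (a 0) (a 1) := by
  have h : (Finset.univ : Finset (Fin 2)) = {0, 1} := rfl
  simp [demographicParity, h]

lemma min_div_max_nonneg {x y : ℝ} (hx : 0 ≤ x) (hy : 0 ≤ y) : 0 ≤ min x y / max x y := by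
  positivity

lemma min_div_max_le_one {x y : ℝ} (hx : 0 ≤ x) : min x y / max x y ≤ 1 :=
  div_le_one_of_le₀ min_le_max (hx.trans (le_max_left x y))

lemma min_div_max_sub_one {x y : ℝ} (h : 0 < max x y) :
    min x y / max x y - 1 = -(|x - y| * (max x y)⁻¹) := by
  rw [div_sub_one h.ne', ← neg_sub, max_sub_min_eq_abs', neg_div, div_eq_mul_inv]

section Limit

variable {Ω Ω' : Type*} [MeasurableSpace Ω] [MeasurableSpace Ω'] {P : Measure Ω}
  [IsProbabilityMeasure P] {P' : Measure Ω'} [IsProbabilityMeasure P']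

/-- Where `max a b > 0`, one has `min a b / max a b - 1 = -|a - b| / max a b`. Since `max a b → s`
almost surely and `s > 0`, this identity eventually holds, and Slutsky's theorem applies to it. -/
theorem tendstoInDistribution_sqrt_mul_min_div_max_sub_one {s : ℝ} (hs : 0 < s) {n : ℕ → ℕ}
    {a b : ℕ → Ω → ℝ} (ha : ∀ k, Measurable (a k)) (hb : ∀ k, Measurable (b k))
    (has : ∀ᵐ ω ∂P, Tendsto (fun k => a k ω) atTop (𝓝 s))
    (hbs : ∀ᵐ ω ∂P, Tendsto (fun k => b k ω) atTop (𝓝 s)) {G : Ω' → ℝ}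
    (hG : TendstoInDistribution (fun k ω => √(n k : ℝ) * (a k ω - b k ω)) atTop G
      (fun _ => P) P') :
    TendstoInDistribution
      (fun k ω => √(n k : ℝ) * (min (a k ω) (b k ω) / max (a k ω) (b k ω) - 1)) atTop
      (fun ω' => -(|G ω'| * s⁻¹)) (fun _ => P) P' := by
  have hmax : ∀ᵐ ω ∂P, Tendsto (fun k => max (a k ω) (b k ω)) atTop (𝓝 s) := by
    filter_upwards [has, hbs] with ω h1 h2
    simpa using h1.max h2
  have hinv : TendstoInMeasure P (fun k ω => (max (a k ω) (b k ω))⁻¹) atTop (fun _ => s⁻¹) := by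
    refine tendstoInMeasure_of_tendsto_ae
      (fun k => ((ha k).max (hb k)).inv.aestronglyMeasurable) ?_
    filter_upwards [hmax] with ω h
    exact h.inv₀ hs.ne'
  have key := hG.continuous_comp_prodMk_of_tendstoInMeasure_const
    (g := fun p : ℝ × ℝ => -(|p.1| * p.2)) (by fun_prop) hinv
    fun k => ((ha k).max (hb k)).inv.aemeasurable
  refine key.of_ae_eventuallyEq (fun k => by
    have := ha k; have := hb k; fun_prop) ?_
  filter_upwards [hmax] with ω h
  filter_upwards [h.eventually (lt_mem_nhds hs)] with k hk
  rw [min_div_max_sub_one hk, abs_mul, abs_of_nonneg (Real.sqrt_nonneg _)]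
  ring

end Limit

/-! ### The negative half-normal law -/

section HalfNormal

instance isProbabilityMeasure_negHalfNormal (τ : ℝ) : IsProbabilityMeasure (negHalfNormal τ) :=
  Measure.isProbabilityMeasure_map (by fun_prop)

lemma negHalfNormal_Ioi_zero (τ : ℝ) : negHalfNormal τ (Set.Ioi 0) = 0 := by
  rw [negHalfNormal, Measure.map_apply (by fun_prop) measurableSet_Ioi]
  have : (fun x : ℝ => -|x|) ⁻¹' Set.Ioi 0 = ∅ := by
    ext x; simp
  rw [this, measure_empty]

lemma negHalfNormal_singleton {τ : ℝ} (hτ : τ ≠ 0) (m : ℝ) : negHalfNormal τ {m} = 0 := by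
  have hv : Real.toNNReal (τ ^ 2) ≠ 0 := (Real.toNNReal_pos.2 (by positivity)).ne'
  have := nullSingletonClass_gaussianReal (μ := 0) hv
  rw [negHalfNormal, Measure.map_apply (by fun_prop) (measurableSet_singleton m)]
  refine ((Set.toFinite {m, -m}).subset fun x hx => ?_).measure_zero _
  have hx' : -|x| = m := hx
  rcases abs_choice x with h | h <;> rw [h] at hx' <;> simp [← hx']

/-- A Dirac mass has an atom, and a nondegenerate normal law charges `(0, ∞)`; the negative
half-normal law does neither. -/
lemma negHalfNormal_ne_gaussianReal {τ : ℝ} (hτ : τ ≠ 0) (m : ℝ) (v : NNReal) :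
    negHalfNormal τ ≠ gaussianReal m v := by
  intro h
  rcases eq_or_ne v 0 with rfl | hv
  · have h1 := negHalfNormal_singleton hτ m
    rw [h, gaussianReal_zero_var] at h1
    simp at h1
  · have h1 := negHalfNormal_Ioi_zero τ
    rw [h] at h1
    have h2 := gaussianReal_absolutelyContinuous' m hv h1
    simp at h2

lemma integral_negHalfNormal_ne_zero {τ : ℝ} (hτ : τ ≠ 0) : ∫ x, x ∂negHalfNormal τ ≠ 0 := by
  have hv : Real.toNNReal (τ ^ 2) ≠ 0 := (Real.toNNReal_pos.2 (by positivity)).ne'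
  have := nullSingletonClass_gaussianReal (μ := 0) hv
  rw [negHalfNormal, integral_map (by fun_prop) (by fun_prop), integral_neg, neg_ne_zero]
  intro h
  have hint : Integrable (fun x : ℝ => |x|) (gaussianReal 0 (Real.toNNReal (τ ^ 2))) :=
    ((memLp_id_gaussianReal 1).integrable (by simp)).abs
  have h0 := (integral_eq_zero_iff_of_nonneg (fun x => abs_nonneg x) hint).1 h
  have h1 : ({0} : Set ℝ) ∈ ae (gaussianReal 0 (Real.toNNReal (τ ^ 2))) := by
    filter_upwards [h0] with x hx
    exact abs_eq_zero.1 hx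
  rw [mem_ae_iff_prob_eq_one (measurableSet_singleton 0), measure_singleton] at h1
  exact zero_ne_one h1

end HalfNormal

/-! ### Differences of independent standard normal variables -/

section Gaussian

variable {Ω' : Type*} [MeasurableSpace Ω'] {P' : Measure Ω'} {Z₁ Z₂ : Ω' → ℝ}

lemma hasLaw_const_mul_sub_gaussianReal (hZ₁ : HasLaw Z₁ (gaussianReal 0 1) P')
    (hZ₂ : HasLaw Z₂ (gaussianReal 0 1) P') (hZ : IndepFun Z₁ Z₂ P') {c v : ℝ}
    (hv : 2 * c ^ 2 = v) :
    HasLaw (fun ω' => c * (Z₁ ω' - Z₂ ω')) (gaussianReal 0 v.toNNReal) P' := by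
  have hneg := gaussianReal_neg hZ₂
  have hsub : HasLaw (fun ω' => Z₁ ω' - Z₂ ω') (gaussianReal 0 2) P' := by
    refine ⟨hZ₁.aemeasurable.sub hZ₂.aemeasurable, ?_⟩
    have := gaussianReal_add_gaussianReal_of_indepFun hZ.neg_right hZ₁.map_eq hneg.map_eq
    rw [← sub_eq_add_neg] at this
    rwa [neg_zero, add_zero, one_add_one_eq_two] at this
  convert gaussianReal_const_mul hsub c using 2
  · simp
  · ext
    rw [Real.coe_toNNReal _ (by rw [← hv]; positivity), ← hv]
    simp [mul_comm]

lemma hasLaw_neg_mul_abs_sub {c τ : ℝ} (hZ₁ : HasLaw Z₁ (gaussianReal 0 1) P')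
    (hZ₂ : HasLaw Z₂ (gaussianReal 0 1) P') (hZ : IndepFun Z₁ Z₂ P') (hc : 0 ≤ c)
    (hτ : 2 * c ^ 2 = τ ^ 2) :
    HasLaw (fun ω' => -c * |Z₁ ω' - Z₂ ω'|) (negHalfNormal τ) P' := by
  have h1 : HasLaw (fun x : ℝ => -|x|) (negHalfNormal τ) (gaussianReal 0 (τ ^ 2).toNNReal) :=
    ⟨by fun_prop, rfl⟩
  convert h1.comp (hasLaw_const_mul_sub_gaussianReal hZ₁ hZ₂ hZ hτ) using 2 with ω'
  rw [Function.comp_apply, abs_mul, abs_of_nonneg hc, neg_mul]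

end Gaussian

/-! ### Consequences of a negative half-normal limit -/

section Conclusion

variable {Ω : Type*} [MeasurableSpace Ω] {P : Measure Ω} [IsProbabilityMeasure P] {n : ℕ → ℕ}
  {T : ℕ → Ω → ℝ} {θ τ : ℝ}

lemma not_asymptoticallyNormal (hτ : τ ≠ 0)
    (h : TendstoInDistribution (scaledError n T θ) atTop (id : ℝ → ℝ) (fun _ => P)
      (negHalfNormal τ)) : ¬ AsymptoticallyNormal P n T θ := by
  rintro ⟨m, v, hmv⟩
  have := tendstoInDistribution_unique _ h hmv
  rw [Measure.map_id, Measure.map_id] at this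
  exact negHalfNormal_ne_gaussianReal hτ m v this

lemma not_asymptoticallyUnbiasedInLaw (hτ : τ ≠ 0)
    (h : TendstoInDistribution (scaledError n T θ) atTop (id : ℝ → ℝ) (fun _ => P)
      (negHalfNormal τ)) : ¬ AsymptoticallyUnbiasedInLaw P n T θ := by
  rintro ⟨ν, _, hν, -, hmean⟩
  have := tendstoInDistribution_unique _ h hν
  rw [Measure.map_id, Measure.map_id] at this
  exact integral_negHalfNormal_ne_zero hτ (this ▸ hmean)

/-- An estimator that never exceeds `θ` satisfies `E|√N (T - θ)| = -√N (E[T] - θ)`. So if its bias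
vanishes at scale `√N`, its scaled error tends to `0` in `L¹`, hence in distribution, and the point
mass at `0` is a (degenerate) normal law. -/
lemma asymptoticallyNormal_of_asymptoticallyUnbiasedInMean (hT : ∀ k, Integrable (T k) P)
    (hle : ∀ k, ∀ᵐ ω ∂P, T k ω ≤ θ) (h : AsymptoticallyUnbiasedInMean P n T θ) :
    AsymptoticallyNormal P n T θ := by
  have hint : ∀ k, Integrable (scaledError n T θ k) P := fun k =>
    ((hT k).sub (integrable_const θ)).const_mul _
  have hnorm : ∀ k, ∫ ω, ‖scaledError n T θ k ω‖ ∂P = -(√(n k : ℝ) * ((∫ ω, T k ω ∂P) - θ)) := by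
    intro k
    have : ∀ᵐ ω ∂P, ‖scaledError n T θ k ω‖ = -(√(n k : ℝ) * (T k ω - θ)) := by
      filter_upwards [hle k] with ω hω
      exact abs_of_nonpos (mul_nonpos_of_nonneg_of_nonpos (Real.sqrt_nonneg _) (by linarith))
    rw [integral_congr_ae this, integral_neg, integral_const_mul,
      integral_sub (hT k) (integrable_const θ)]
    simp
  have hlim : TendstoInMeasure P (scaledError n T θ) atTop (fun _ => (0 : ℝ)) := by
    refine tendstoInMeasure_of_tendsto_eLpNorm (p := 1) one_ne_zero
      (fun k => (hint k).aestronglyMeasurable) aestronglyMeasurable_const ?_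
    have h0 : Tendsto (fun k => ENNReal.ofReal (∫ ω, ‖scaledError n T θ k ω‖ ∂P)) atTop (𝓝 0) := by
      rw [← ENNReal.ofReal_zero]
      refine ENNReal.tendsto_ofReal ?_
      simp_rw [hnorm]
      simpa using Tendsto.neg h
    refine h0.congr fun k => ?_
    rw [ofReal_integral_norm_eq_lintegral_enorm (hint k), eLpNorm_one_eq_lintegral_enorm]
    simp
  refine ⟨0, 0, ?_⟩
  have hd := hlim.tendstoInDistribution fun k => (hint k).aemeasurable
  refine hd.id_of_hasLaw ⟨aemeasurable_const, ?_⟩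
  simp [gaussianReal_zero_var, Measure.map_const]

end Conclusion

/-! ### Sample means under the two sampling schemes -/

section Sampling

variable {Ω Ω' : Type*} [MeasurableSpace Ω] [MeasurableSpace Ω'] {P : Measure Ω}
  [IsProbabilityMeasure P] {P' : Measure Ω'} [IsProbabilityMeasure P'] {s σ : ℝ}
  {Z₁ Z₂ : Ω' → ℝ}

lemma sum_fin_two_product_zero_one (f : Fin 2 × ℝ → ℝ) :
    ∑ x ∈ (Finset.univ : Finset (Fin 2)) ×ˢ ({0, 1} : Finset ℝ), f x =
      f (0, 0) + f (0, 1) + (f (1, 0) + f (1, 1)) := by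
  simp [Finset.sum_product]

lemma sum_zero_one_product_zero_one (f : ℝ × ℝ → ℝ) :
    ∑ x ∈ ({0, 1} : Finset ℝ) ×ˢ ({0, 1} : Finset ℝ), f x =
      f (0, 0) + f (0, 1) + (f (1, 0) + f (1, 1)) := by
  simp [Finset.sum_product]

/-- The probability that a Bernoulli variable with parameter `s` takes the value `y`; only the
values at `y = 0` and `y = 1` are meaningful. -/
noncomputable def bernoulliWeight (s y : ℝ) : ℝ := if y = 1 then s else 1 - s

@[simp] lemma bernoulliWeight_one : bernoulliWeight s 1 = s := if_pos rfl

@[simp] lemma bernoulliWeight_zero : bernoulliWeight s 0 = 1 - s := if_neg zero_ne_one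

namespace IsMultinomialSample

variable {grp : ℕ → Ω → Fin 2} {Y : ℕ → Ω → ℝ}

omit [IsProbabilityMeasure P] in
lemma isIIDDiscrete (h : IsMultinomialSample P (fun _ => 1 / 2) (fun _ => s) grp Y) :
    IsIIDDiscrete P (fun i ω => (grp i ω, Y i ω)) (Finset.univ ×ˢ {0, 1})
      (fun x => 1 / 2 * bernoulliWeight s x.2) where
  measurable i := (h.measurable_grp i).prodMk (h.measurable_outcome i)
  indep := h.indep
  mass := by
    rintro i ⟨g, y⟩ hx
    simp only [Finset.mem_product, Finset.mem_univ, true_and, Finset.mem_insert,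
      Finset.mem_singleton] at hx
    simp only [Prod.mk.injEq]
    rcases hx with rfl | rfl
    · rw [h.failure i g, bernoulliWeight_zero]
    · rw [h.success i g, bernoulliWeight_one]
  total := by
    rw [sum_fin_two_product_zero_one]
    simp
    ring

omit [IsProbabilityMeasure P] in
lemma measurable_groupMean (h : IsMultinomialSample P (fun _ => 1 / 2) (fun _ => s) grp Y)
    (N : ℕ) (g : Fin 2) : Measurable fun ω => groupMean grp Y N ω g := by
  have hm : ∀ i, MeasurableSet {ω | grp i ω = g} := fun i =>
    h.measurable_grp i (measurableSet_singleton g)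
  exact (Finset.measurable_fun_sum _ fun i _ =>
    (h.measurable_outcome i).ite (hm i) measurable_const).div
    (Finset.measurable_fun_sum _ fun i _ => measurable_const.ite (hm i) measurable_const)

lemma groupMean_nonneg (h : IsMultinomialSample P (fun _ => 1 / 2) (fun _ => s) grp Y) (N : ℕ)
    (g : Fin 2) : ∀ᵐ ω ∂P, 0 ≤ groupMean grp Y N ω g := by
  filter_upwards [h.isIIDDiscrete.ae_mem] with ω hω
  have hY : ∀ i, 0 ≤ Y i ω := fun i => by
    have := hω i
    simp only [Finset.mem_product, Finset.mem_univ, true_and, Finset.mem_insert,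
      Finset.mem_singleton] at this
    rcases this with h | h <;> simp [h]
  refine div_nonneg (Finset.sum_nonneg fun i _ => ?_) (Finset.sum_nonneg fun i _ => ?_) <;>
    split_ifs <;> simp [hY]

lemma ae_tendsto_size_div (h : IsMultinomialSample P (fun _ => 1 / 2) (fun _ => s) grp Y)
    (g : Fin 2) :
    ∀ᵐ ω ∂P, Tendsto
      (fun N : ℕ => (∑ i ∈ Finset.range N, if grp i ω = g then (1 : ℝ) else 0) / N) atTop
      (𝓝 (1 / 2)) := by
  have hφ : Measurable fun x : Fin 2 × ℝ => if x.1 = g then (1 : ℝ) else 0 :=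
    measurable_const.ite (measurable_fst (measurableSet_singleton g)) measurable_const
  have := h.isIIDDiscrete.strong_law hφ
  rw [sum_fin_two_product_zero_one] at this
  convert this using 5
  fin_cases g <;> simp <;> ring

lemma ae_tendsto_groupMean (h : IsMultinomialSample P (fun _ => 1 / 2) (fun _ => s) grp Y)
    (g : Fin 2) : ∀ᵐ ω ∂P, Tendsto (fun N => groupMean grp Y N ω g) atTop (𝓝 s) := by
  have hφ : Measurable fun x : Fin 2 × ℝ => if x.1 = g then x.2 else 0 :=
    measurable_snd.ite (measurable_fst (measurableSet_singleton g)) measurable_const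
  have hsum := h.isIIDDiscrete.strong_law hφ
  have hmean : ∑ x ∈ (Finset.univ : Finset (Fin 2)) ×ˢ ({0, 1} : Finset ℝ),
      1 / 2 * bernoulliWeight s x.2 * (if x.1 = g then x.2 else 0) = s / 2 := by
    rw [sum_fin_two_product_zero_one]
    fin_cases g <;> simp <;> ring
  rw [hmean] at hsum
  filter_upwards [hsum, h.ae_tendsto_size_div g] with ω h1 h2
  have h3 := h1.div h2 (by norm_num)
  rw [div_div_div_cancel_right₀ (by norm_num), div_one] at h3
  refine h3.congr' ?_
  filter_upwards [eventually_gt_atTop 0] with N hN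
  exact div_div_div_cancel_right₀ (by positivity) _ _

/-- With `A g = N^{-1/2} ∑_{i in group g} (Y i - s)` and `r g = N / (size of group g)`, the scaled
difference of the group means is `r 0 * A 0 - r 1 * A 1 = r 0 * (A 0 - A 1) + (r 0 - r 1) * A 1`.
The random ratios `r g` tend to `2`, so the first term converges by the central limit theorem for
the single sequence defining `A 0 - A 1`, and the second one is negligible. No multivariate central
limit theorem is needed. -/
theorem tendstoInDistribution_groupMean_sub
    (h : IsMultinomialSample P (fun _ => 1 / 2) (fun _ => s) grp Y) (hσ : σ ^ 2 = s * (1 - s))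
    (hZ₁ : HasLaw Z₁ (gaussianReal 0 1) P') (hZ₂ : HasLaw Z₂ (gaussianReal 0 1) P')
    (hZ : IndepFun Z₁ Z₂ P') :
    TendstoInDistribution
      (fun (N : ℕ) ω => √(N : ℝ) * (groupMean grp Y N ω 0 - groupMean grp Y N ω 1)) atTop
      (fun ω' => √2 * σ * (Z₁ ω' - Z₂ ω')) (fun _ => P) P' := by
  let φ : Fin 2 → Fin 2 × ℝ → ℝ := fun g x => if x.1 = g then x.2 - s else 0
  have hφ : ∀ g, Measurable (φ g) := fun g =>
    (measurable_snd.sub_const s).ite (measurable_fst (measurableSet_singleton g)) measurable_const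
  let A : Fin 2 → ℕ → Ω → ℝ := fun g N ω =>
    (√N)⁻¹ * ∑ i ∈ Finset.range N, φ g (grp i ω, Y i ω)
  let r : Fin 2 → ℕ → Ω → ℝ := fun g N ω =>
    ((∑ i ∈ Finset.range N, if grp i ω = g then (1 : ℝ) else 0) / N)⁻¹
  have hAm : ∀ g N, Measurable (A g N) := fun g N =>
    (Finset.measurable_fun_sum _ fun i _ => (hφ g).comp (h.isIIDDiscrete.measurable i)).const_mul _
  have hrm : ∀ g N, Measurable (r g N) := fun g N =>
    ((Finset.measurable_fun_sum _ fun i _ => measurable_const.ite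
      (h.measurable_grp i (measurableSet_singleton g)) measurable_const).div_const _).inv
  have hr : ∀ g, ∀ᵐ ω ∂P, Tendsto (fun N => r g N ω) atTop (𝓝 2) := fun g => by
    filter_upwards [h.ae_tendsto_size_div g] with ω hω
    have := hω.inv₀ (by norm_num)
    rwa [one_div, inv_inv] at this
  -- the two central limit theorems
  have hdiff : TendstoInDistribution (fun N ω => A 0 N ω - A 1 N ω) atTop
      (fun ω' => √2 / 2 * σ * (Z₁ ω' - Z₂ ω')) (fun _ => P) P' := by
    have := h.isIIDDiscrete.central_limit (P' := P') (φ := fun x => φ 0 x - φ 1 x)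
      (v := s * (1 - s)) ((hφ 0).sub (hφ 1))
      (by rw [sum_fin_two_product_zero_one]; simp [φ]; ring)
      (by rw [sum_fin_two_product_zero_one]; simp [φ]; ring)
      (hasLaw_const_mul_sub_gaussianReal (c := √2 / 2 * σ) hZ₁ hZ₂ hZ (by
        rw [mul_pow, div_pow, Real.sq_sqrt zero_le_two, hσ]; ring))
    simpa only [A, ← mul_sub, ← Finset.sum_sub_distrib] using this
  have hone : TendstoInDistribution (A 1) atTop id (fun _ => P)
      (gaussianReal 0 (s * (1 - s) / 2).toNNReal) :=
    h.isIIDDiscrete.central_limit (hφ 1)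
      (by rw [sum_fin_two_product_zero_one]; simp [φ]; ring)
      (by rw [sum_fin_two_product_zero_one]; simp [φ]; ring) HasLaw.id
  have hmain : TendstoInDistribution (fun N ω => r 0 N ω * (A 0 N ω - A 1 N ω)) atTop
      (fun ω' => √2 * σ * (Z₁ ω' - Z₂ ω')) (fun _ => P) P' := by
    have := hdiff.continuous_comp_prodMk_of_tendstoInMeasure_const
      (g := fun p : ℝ × ℝ => p.2 * p.1) (by fun_prop)
      (tendstoInMeasure_of_tendsto_ae (fun N => (hrm 0 N).aestronglyMeasurable) (hr 0))
      fun N => (hrm 0 N).aemeasurable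
    convert this using 2 with ω'
    ring
  have hrest : TendstoInMeasure P (fun N ω => (r 0 N ω - r 1 N ω) * A 1 N ω) atTop
      (fun _ => 0) := by
    refine hone.mul_tendstoInMeasure_zero (tendstoInMeasure_of_tendsto_ae
      (fun N => ((hrm 0 N).sub (hrm 1 N)).aestronglyMeasurable) ?_)
      fun N => ((hrm 0 N).sub (hrm 1 N)).aemeasurable
    filter_upwards [hr 0, hr 1] with ω h0 h1
    simpa using h0.sub h1
  have hsum := hmain.add_of_tendstoInMeasure_const hrest
    fun N => (((hrm 0 N).sub (hrm 1 N)).mul (hAm 1 N)).aemeasurable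
  simp only [add_zero] at hsum
  refine hsum.of_ae_eventuallyEq (fun N => (((h.measurable_groupMean N 0).sub
    (h.measurable_groupMean N 1)).const_mul _).aemeasurable) ?_
  -- the formula for `√N (mean - s)` can fail only while group `g` is empty
  have hkey : ∀ g, ∀ᵐ ω ∂P, ∀ᶠ N : ℕ in atTop,
      √(N : ℝ) * (groupMean grp Y N ω g - s) = r g N ω * A g N ω := fun g => by
    filter_upwards [h.ae_tendsto_size_div g] with ω hω
    filter_upwards [hω.eventually (lt_mem_nhds (by norm_num : (0 : ℝ) < 1 / 2)),
      eventually_gt_atTop 0] with N hN hN0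
    have hN' : (0 : ℝ) < N := by exact_mod_cast hN0
    have hc : (∑ i ∈ Finset.range N, if grp i ω = g then (1 : ℝ) else 0) ≠ 0 := by
      intro h0
      rw [h0, zero_div] at hN
      exact lt_irrefl _ hN
    have hφs : ∑ i ∈ Finset.range N, φ g (grp i ω, Y i ω) =
        (∑ i ∈ Finset.range N, if grp i ω = g then Y i ω else 0) -
          s * ∑ i ∈ Finset.range N, if grp i ω = g then (1 : ℝ) else 0 := by
      rw [Finset.mul_sum, ← Finset.sum_sub_distrib]
      refine Finset.sum_congr rfl fun i _ => ?_
      simp only [φ]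
      split_ifs <;> simp
    simp only [A, r, hφs, groupMean]
    have hsq : √(N : ℝ) ≠ 0 := (Real.sqrt_pos.2 hN').ne'
    have hsq2 : (N : ℝ) = √(N : ℝ) * √(N : ℝ) := (Real.mul_self_sqrt hN'.le).symm
    generalize (∑ i ∈ Finset.range N, if grp i ω = g then (1 : ℝ) else 0) = c at hc ⊢
    rw [inv_div]
    nth_rw 2 [hsq2]
    field_simp
  filter_upwards [hkey 0, hkey 1] with ω h0 h1
  filter_upwards [h0, h1] with N h0 h1
  simp only [Pi.add_apply]
  linear_combination h0 - h1

end IsMultinomialSample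

namespace IsStratifiedSample

variable {Y : Fin 2 → ℕ → Ω → ℝ}

omit [IsProbabilityMeasure P] in
lemma isIIDDiscrete (h : IsStratifiedSample P (fun _ => s) Y) :
    IsIIDDiscrete P (fun i ω => (Y 0 i ω, Y 1 i ω)) ({0, 1} ×ˢ {0, 1})
      (fun x => bernoulliWeight s x.1 * bernoulliWeight s x.2) where
  measurable i := (h.measurable_outcome 0 i).prodMk (h.measurable_outcome 1 i)
  indep := (h.indep.curry_swap h.measurable_outcome).comp (fun _ f => (f 0, f 1))
    fun _ => by fun_prop
  mass := by
    rintro i ⟨x, y⟩ hx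
    have hone : ∀ g, ∀ y ∈ ({0, 1} : Finset ℝ), P.real (Y g i ⁻¹' {y}) = bernoulliWeight s y := by
      intro g y hy
      simp only [Finset.mem_insert, Finset.mem_singleton] at hy
      rcases hy with rfl | rfl
      · rw [bernoulliWeight_zero]; exact h.failure g i
      · rw [bernoulliWeight_one]; exact h.success g i
    rw [Finset.mem_product] at hx
    have hind : IndepFun (Y 0 i) (Y 1 i) P :=
      h.indep.indepFun (i := ((0 : Fin 2), i)) (j := ((1 : Fin 2), i)) (by simp)
    have hset : {ω | (Y 0 i ω, Y 1 i ω) = (x, y)} = Y 0 i ⁻¹' {x} ∩ Y 1 i ⁻¹' {y} := by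
      ext ω
      simp
    rw [hset, measureReal_def, hind.measure_inter_preimage_eq_mul _ _ (measurableSet_singleton x)
      (measurableSet_singleton y), ENNReal.toReal_mul]
    exact congrArg₂ (· * ·) (hone 0 x hx.1) (hone 1 y hx.2)
  total := by
    rw [sum_zero_one_product_zero_one]
    simp
    ring

omit [IsProbabilityMeasure P] in
lemma measurable_stratumMean (h : IsStratifiedSample P (fun _ => s) Y) (M : ℕ) (g : Fin 2) :
    Measurable fun ω => stratumMean Y M ω g :=
  (Finset.measurable_fun_sum _ fun i _ => h.measurable_outcome g i).div_const _

lemma stratumMean_nonneg (h : IsStratifiedSample P (fun _ => s) Y) (M : ℕ) (g : Fin 2) :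
    ∀ᵐ ω ∂P, 0 ≤ stratumMean Y M ω g := by
  filter_upwards [h.isIIDDiscrete.ae_mem] with ω hω
  refine div_nonneg (Finset.sum_nonneg fun i _ => ?_) (Nat.cast_nonneg _)
  have := hω i
  simp only [Finset.mem_product, Finset.mem_insert, Finset.mem_singleton] at this
  fin_cases g
  · rcases this.1 with h | h <;> simp [h]
  · rcases this.2 with h | h <;> simp [h]

lemma ae_tendsto_stratumMean (h : IsStratifiedSample P (fun _ => s) Y) (g : Fin 2) :
    ∀ᵐ ω ∂P, Tendsto (fun M => stratumMean Y M ω g) atTop (𝓝 s) := by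
  have h0 := h.isIIDDiscrete.strong_law measurable_fst
  have h1 := h.isIIDDiscrete.strong_law measurable_snd
  rw [sum_zero_one_product_zero_one] at h0 h1
  simp only [bernoulliWeight_zero, bernoulliWeight_one, mul_zero, mul_one, zero_add, add_zero]
    at h0 h1
  rw [← mul_add, sub_add_cancel, mul_one] at h0
  rw [← add_mul, sub_add_cancel, one_mul] at h1
  fin_cases g
  exacts [h0, h1]

/-- The scaled difference is `√2` times the normalized sum of the centred independent differences
`Y 0 i - Y 1 i`, whose variance is `2 s (1 - s)`. -/
theorem tendstoInDistribution_stratumMean_sub (h : IsStratifiedSample P (fun _ => s) Y)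
    (hσ : σ ^ 2 = s * (1 - s))
    (hZ₁ : HasLaw Z₁ (gaussianReal 0 1) P') (hZ₂ : HasLaw Z₂ (gaussianReal 0 1) P')
    (hZ : IndepFun Z₁ Z₂ P') :
    TendstoInDistribution
      (fun (M : ℕ) ω => √((2 * M : ℕ) : ℝ) * (stratumMean Y M ω 0 - stratumMean Y M ω 1)) atTop
      (fun ω' => √2 * σ * (Z₁ ω' - Z₂ ω')) (fun _ => P) P' := by
  have hclt := h.isIIDDiscrete.central_limit (P' := P') (φ := fun x => x.1 - x.2)
    (v := 2 * (s * (1 - s))) (by fun_prop)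
    (by rw [sum_zero_one_product_zero_one]; simp; ring)
    (by rw [sum_zero_one_product_zero_one]; simp; ring)
    (hasLaw_const_mul_sub_gaussianReal (c := σ) hZ₁ hZ₂ hZ (by rw [hσ]))
  have := hclt.continuous_comp (g := fun x => √2 * x) (by fun_prop)
  refine (this.congr (fun M => ae_of_all _ fun ω => ?_) (ae_of_all _ fun ω' => ?_))
  · have hM : √(M : ℝ) / M = (√(M : ℝ))⁻¹ := Real.sqrt_div_self
    simp only [Function.comp_apply, stratumMean, Finset.sum_sub_distrib]
    rw [← hM, Nat.cast_mul, Nat.cast_ofNat, Real.sqrt_mul zero_le_two]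
    ring
  · simp only [Function.comp_apply]
    ring

end IsStratifiedSample

end Sampling

/-! ### Demographic parity of two equally sized groups with equal rates -/

theorem mainTheorem3 {Ω Ω' : Type*} [MeasurableSpace Ω] [MeasurableSpace Ω']
    (P : Measure Ω) [IsProbabilityMeasure P] (P' : Measure Ω') [IsProbabilityMeasure P']
    (s σ DP₀ : ℝ) (hs0 : 0 < s) (hs1 : s < 1) (hσ : σ = √(s * (1 - s)))
    (hDP₀ : DP₀ = demographicParity (fun _ : Fin 2 => s))
    -- two independent standard normal variables
    (Z₁ Z₂ : Ω' → ℝ) (hZ₁ : HasLaw Z₁ (gaussianReal 0 1) P')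
    (hZ₂ : HasLaw Z₂ (gaussianReal 0 1) P') (hZ : IndepFun Z₁ Z₂ P')
    -- `DP k` is the estimator from a sample of total size `n k` from two equally sized groups:
    -- either the groups are sampled with probability `1 / 2` each, or they have equal fixed sizes
    (n : ℕ → ℕ) (DP : ℕ → Ω → ℝ)
    (hDP :
      (∃ (grp : ℕ → Ω → Fin 2) (Y : ℕ → Ω → ℝ),
        IsMultinomialSample P (fun _ => 1 / 2) (fun _ => s) grp Y ∧
          (∀ N, n N = N) ∧ ∀ N ω, DP N ω = demographicParity (groupMean grp Y N ω)) ∨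
      (∃ Y : Fin 2 → ℕ → Ω → ℝ,
        IsStratifiedSample P (fun _ => s) Y ∧
          (∀ M, n M = 2 * M) ∧ ∀ M ω, DP M ω = demographicParity (stratumMean Y M ω))) :
    DP₀ = 1 ∧
    (∀ k, ∀ᵐ ω ∂P, DP k ω ≤ DP₀) ∧
    (∀ k, ∀ᵐ ω ∂P, √(n k : ℝ) * (DP k ω - DP₀) ≤ 0) ∧
    TendstoInDistribution (fun k ω => √(n k : ℝ) * (DP k ω - DP₀)) atTop
      (fun ω' => -(√2 * σ / s) * |Z₁ ω' - Z₂ ω'|) (fun _ => P) P' ∧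
    HasLaw (fun ω' => -(√2 * σ / s) * |Z₁ ω' - Z₂ ω'|) (negHalfNormal (2 * σ / s)) P' ∧
    (∀ k, Integrable (DP k) P) ∧
    ¬ AsymptoticallyUnbiasedInLaw P n DP DP₀ ∧
    ¬ AsymptoticallyUnbiasedInMean P n DP DP₀ ∧
    ¬ AsymptoticallyNormal P n DP DP₀ := by
  have hσ2 : σ ^ 2 = s * (1 - s) := by
    rw [hσ, Real.sq_sqrt (mul_nonneg hs0.le (by linarith))]
  have hσ0 : 0 < σ := by
    rw [hσ]
    exact Real.sqrt_pos.2 (mul_pos hs0 (by linarith))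
  have hDP₀1 : DP₀ = 1 := by
    rw [hDP₀, demographicParity_fin_two, min_self, max_self, div_self hs0.ne']
  -- what the two sampling schemes have in common
  obtain ⟨a, b, ha, hb, ha0, hb0, has, hbs, hab, hdp⟩ : ∃ a b : ℕ → Ω → ℝ,
      (∀ k, Measurable (a k)) ∧ (∀ k, Measurable (b k)) ∧
      (∀ k, ∀ᵐ ω ∂P, 0 ≤ a k ω) ∧ (∀ k, ∀ᵐ ω ∂P, 0 ≤ b k ω) ∧
      (∀ᵐ ω ∂P, Tendsto (fun k => a k ω) atTop (𝓝 s)) ∧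
      (∀ᵐ ω ∂P, Tendsto (fun k => b k ω) atTop (𝓝 s)) ∧
      TendstoInDistribution (fun k ω => √(n k : ℝ) * (a k ω - b k ω)) atTop
        (fun ω' => √2 * σ * (Z₁ ω' - Z₂ ω')) (fun _ => P) P' ∧
      ∀ k ω, DP k ω = min (a k ω) (b k ω) / max (a k ω) (b k ω) := by
    rcases hDP with ⟨grp, Y, h, hn, hDP⟩ | ⟨Y, h, hn, hDP⟩
    · refine ⟨fun N ω => groupMean grp Y N ω 0, fun N ω => groupMean grp Y N ω 1,
        fun N => h.measurable_groupMean N 0, fun N => h.measurable_groupMean N 1,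
        fun N => h.groupMean_nonneg N 0, fun N => h.groupMean_nonneg N 1,
        h.ae_tendsto_groupMean 0, h.ae_tendsto_groupMean 1, ?_, fun N ω => by
          rw [hDP, demographicParity_fin_two]⟩
      simp_rw [hn]
      exact h.tendstoInDistribution_groupMean_sub hσ2 hZ₁ hZ₂ hZ
    · refine ⟨fun M ω => stratumMean Y M ω 0, fun M ω => stratumMean Y M ω 1,
        fun M => h.measurable_stratumMean M 0, fun M => h.measurable_stratumMean M 1,
        fun M => h.stratumMean_nonneg M 0, fun M => h.stratumMean_nonneg M 1,
        h.ae_tendsto_stratumMean 0, h.ae_tendsto_stratumMean 1, ?_, fun M ω => by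
          rw [hDP, demographicParity_fin_two]⟩
      simp_rw [hn]
      exact h.tendstoInDistribution_stratumMean_sub hσ2 hZ₁ hZ₂ hZ
  have hle : ∀ k, ∀ᵐ ω ∂P, DP k ω ≤ DP₀ := fun k => by
    filter_upwards [ha0 k] with ω h
    rw [hDP₀1, hdp]
    exact min_div_max_le_one h
  have hint : ∀ k, Integrable (DP k) P := fun k => by
    have hm : Measurable (DP k) := by
      rw [funext (hdp k)]
      exact ((ha k).min (hb k)).div ((ha k).max (hb k))
    refine Integrable.of_bound hm.aestronglyMeasurable 1 ?_
    filter_upwards [ha0 k, hb0 k] with ω h1 h2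
    rw [hdp, Real.norm_eq_abs, abs_of_nonneg (min_div_max_nonneg h1 h2)]
    exact min_div_max_le_one h1
  have hlim : TendstoInDistribution (fun k ω => √(n k : ℝ) * (DP k ω - DP₀)) atTop
      (fun ω' => -(√2 * σ / s) * |Z₁ ω' - Z₂ ω'|) (fun _ => P) P' := by
    have := tendstoInDistribution_sqrt_mul_min_div_max_sub_one hs0 ha hb has hbs hab
    simp_rw [hDP₀1, hdp]
    convert this using 2 with ω'
    rw [abs_mul, abs_of_pos (show 0 < √2 * σ by positivity)]
    ring
  have hlaw : HasLaw (fun ω' => -(√2 * σ / s) * |Z₁ ω' - Z₂ ω'|) (negHalfNormal (2 * σ / s)) P' :=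
    hasLaw_neg_mul_abs_sub hZ₁ hZ₂ hZ (by positivity) (by
      rw [div_pow, div_pow, mul_pow, mul_pow, Real.sq_sqrt zero_le_two]
      ring)
  have hτ : 2 * σ / s ≠ 0 := by positivity
  have hlim' : TendstoInDistribution (scaledError n DP DP₀) atTop (id : ℝ → ℝ) (fun _ => P)
      (negHalfNormal (2 * σ / s)) :=
    hlim.id_of_hasLaw hlaw
  have hnormal := not_asymptoticallyNormal hτ hlim'
  refine ⟨hDP₀1, hle, fun k => ?_, hlim, hlaw, hint, not_asymptoticallyUnbiasedInLaw hτ hlim',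
    fun h => hnormal (asymptoticallyNormal_of_asymptoticallyUnbiasedInMean hint hle h), hnormal⟩
  filter_upwards [hle k] with ω h
  exact mul_nonpos_of_nonneg_of_nonpos (Real.sqrt_nonneg _) (by linarith)
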